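/- Let $b\ge 2$ and $k>2b$ be integers, and let $\mathcal A=\{A_1,\dots,A_n\}$ be a finite (indexed) family of subsets of $\mathbb R^2$. For $\sigma\subseteq[n]=\{1,\dots,n\}$ put $A_\sigma=\bigcap_{i\in\sigma}A_i$, let $N(\mathcal A)=\{\sigma\subseteq[n] : A_\sigma\neq\emptyset\}$ be the nerve of $\mathcal A$, and for $j\ge 0$ put $$f_j(\mathcal A)=|\{\sigma\in N(\mathcal A) : |\sigma|=j+1\}|,$$ $$f^{\mathrm{ind}}_j(\mathcal A)=|\{\tau\in N(\mathcal A) : |\tau|=j+1 \text{ and there is } \sigma\in N(\mathcal A) \text{ with } \sigma\supset\tau,\ |\sigma|=j+2\}|.$$ Suppose that (i) $f_{k+1}(\mathcal A)=0$, and (ii) for every $\sigma\subseteq[n]$ with $|\sigma|\in\{k,k+1\}$, the set $A_\sigma$ is open (possibly empty) and has at most $b$ path-connected components. Then $f_k(\mathcal A)\le c\, f^{\mathrm{ind}}_{k-1}(\mathcal A)$ with the positive constant $c=c(b,k)=\dfrac{b}{k-2b}$. -/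

import Mathlib

namespace PlanarNerve

/-- The intersection of the members of the family `A` with index in `σ`
(the whole ambient space for `σ = ∅`). -/
def interOf {X : Type*} {n : ℕ} (A : Fin n → Set X) (σ : Finset (Fin n)) : Set X :=
  ⋂ i ∈ σ, A i

/-- The nerve of a finite indexed family of sets: the index sets with nonempty intersection. -/
def nerve {X : Type*} {n : ℕ} (A : Fin n → Set X) : Set (Finset (Fin n)) :=
  {σ | (interOf A σ).Nonempty}

/-- The number `f_k` of faces of the nerve with `k + 1` elements. -/
noncomputable def fNum {X : Type*} {n : ℕ} (A : Fin n → Set X) (k : ℕ) : ℕ :=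
  {σ | σ ∈ nerve A ∧ σ.card = k + 1}.ncard

/-- The number `f_k^ind` of faces of the nerve with `k + 1` elements that are contained
in a face of the nerve with `k + 2` elements. -/
noncomputable def fInd {X : Type*} {n : ℕ} (A : Fin n → Set X) (k : ℕ) : ℕ :=
  {τ | τ ∈ nerve A ∧ τ.card = k + 1 ∧ ∃ σ ∈ nerve A, τ ⊂ σ ∧ σ.card = k + 2}.ncard

/-- The set `S`, with the subspace topology, has at most `b` path components.
The count takes values in `ℕ∞`, so infinitely many components are excluded. -/
def HasAtMostPathComponents {X : Type*} [TopologicalSpace X] (S : Set X) (b : ℕ) : Prop :=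
  ENat.card (ZerothHomotopy S) ≤ (b : ℕ∞)

end PlanarNerve

/-!
Write `κ` for the set of path components `C` of the sets `A_σ` with `|σ| = k + 1`, and `ι` for the
set of path components `D` of the sets `A_τ` with `|τ| = k` that contain some `C`. No point lies in
`k + 2` of the sets, so the `C` are pairwise disjoint, two different `D` meet only inside common
`C`'s, and each `C` labelled `σ` lies in exactly one `D` for each of the `k + 1` labels `τ ⊂ σ`.

*A planar graph.* Paths inside the `D` connect the `C` they contain. Outside the `C` these paths
do not meet if they belong to different `D`, so contracting the `C` gives a simple planar graph `Q`
on `κ` that is connected on the `C` inside `D`, for every `D`. To make this precise,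
`exists_simpleGraph_of_isOpen` replaces the regions by the points of a fine square lattice near
compact connected cores of them (`IsPreconnected.gridConnected_latticeNear`), and
`exists_simpleGraph_of_grid` contracts disjoint connected sets of lattice points.

*At most `3 |κ|` edges.* Planarity enters only as in MacLane's criterion. Mod 2 cycles in the square
lattice are sums of boundaries of unit squares (`GridEdge.exists_eq_face_add`). Deleting edges
merges squares into regions and contracting edges forgets them, so the mod 2 cycles of `Q` are
spanned by the boundaries of regions, where each edge lies in at most two of these. The cycle space
has dimension at least `|E| - |κ|`, and a nonzero boundary has at least three edges since `Q` is
simple.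
Thus `|E| - |κ| ≤ 2 |E| / 3` (`card_edges_le_of_cycles_le_span`, `card_edges_le_of_grid_minor`).

*The count* (`mul_ncard_range_label_le`). Contract the edges of `Q` between components with the same
label. If `m` classes are left, these edges number at least `|κ| - m`. Each of the others
lies in at most one `D`, and since `Q` is connected along `D`, their number is at least the sum over
`D` of the number of classes meeting `D`, minus one; this is at least `(k + 1) m - |ι|`. Together
with `|E| ≤ 3 |κ|` this yields `k m ≤ 2 |κ| + |ι| ≤ 2 b f_k + b f_{k-1}^ind`, while `f_k ≤ m`.
-/

/-! ### Counting edges of graphs -/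

/-- Contracting the fibres of `f` in a graph that is connected on `K` leaves a connected graph, so
the edges inside `K` not contracted number at least the size of the image of `K` minus one. -/
theorem SimpleGraph.ncard_image_le_ncard_edges_add_one {V W : Type*} [Finite V]
    (G : SimpleGraph V) (K : Set V) (hK : (G.induce K).Preconnected) (f : V → W) :
    (f '' K).ncard ≤
      {e ∈ G.edgeSet | (∀ v ∈ e, v ∈ K) ∧ ¬ (Sym2.map f e).IsDiag}.ncard + 1 := by
  classical
  rcases K.eq_empty_or_nonempty with rfl | hne
  · simp
  -- the contracted graph, on the image of `K`
  let H : SimpleGraph (f '' K) :=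
    { Adj := fun x y => x ≠ y ∧ ∃ u ∈ K, ∃ v ∈ K, G.Adj u v ∧ f u = x ∧ f v = y
      symm := ⟨by
        rintro x y ⟨h, u, hu, v, hv, ha, h1, h2⟩
        exact ⟨h.symm, v, hv, u, hu, ha.symm, h2, h1⟩⟩
      loopless := ⟨fun x h => h.1 rfl⟩ }
  have hreach : ∀ a b : K, (G.induce K).Reachable a b →
      H.Reachable ⟨f a, a, a.2, rfl⟩ ⟨f b, b, b.2, rfl⟩ := by
    rintro a b ⟨p⟩
    induction p with
    | nil => exact SimpleGraph.Reachable.refl _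
    | @cons u v w h p ih =>
      refine SimpleGraph.Reachable.trans ?_ ih
      by_cases huv : f u = f v
      · have : (⟨f u, u, u.2, rfl⟩ : f '' K) = ⟨f v, v, v.2, rfl⟩ := Subtype.ext huv
        rw [this]
      · refine SimpleGraph.Adj.reachable ?_
        exact ⟨fun h' => huv (congrArg Subtype.val h'), u, u.2, v, v.2, h, rfl, rfl⟩
  have hH : H.Connected := by
    have : Nonempty (f '' K) := ⟨⟨f hne.some, hne.some, hne.some_mem, rfl⟩⟩
    refine ⟨?_⟩
    rintro ⟨_, a, ha, rfl⟩ ⟨_, b, hb, rfl⟩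
    exact hreach ⟨a, ha⟩ ⟨b, hb⟩ (hK _ _)
  have h1 := hH.card_vert_le_card_edgeSet_add_one
  rw [Nat.card_coe_set_eq, Nat.card_coe_set_eq] at h1
  refine h1.trans (Nat.add_le_add_right ?_ 1)
  rw [← Set.ncard_image_of_injective H.edgeSet
    (Sym2.map.injective (Subtype.val_injective (p := fun x => x ∈ f '' K)))]
  refine le_trans (Set.ncard_le_ncard ?_ (Set.toFinite _))
    (Set.ncard_image_le (f := Sym2.map f) (Set.toFinite _))
  rintro _ ⟨e, he, rfl⟩
  induction e with
  | _ x y =>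
    obtain ⟨hxy, u, hu, v, hv, ha, h1, h2⟩ := he
    refine ⟨s(u, v), ⟨ha, ?_, ?_⟩, ?_⟩
    · intro w hw
      rcases Sym2.mem_iff.1 hw with rfl | rfl <;> assumption
    · simp only [Sym2.map_mk, Sym2.mk_isDiag_iff, h1, h2]
      exact fun h => hxy (Subtype.ext h)
    · simp [h1, h2]

/-- A graph with `c` components on `v` vertices has at least `v - c` edges. -/
theorem SimpleGraph.card_le_ncard_edgeSet_add_card_connectedComponent {V : Type*} [Finite V]
    (G : SimpleGraph V) :
    Nat.card V ≤ G.edgeSet.ncard + Nat.card G.ConnectedComponent := by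
  classical
  have := Fintype.ofFinite V
  have := Fintype.ofFinite G.ConnectedComponent
  have hV : Nat.card V = ∑ c : G.ConnectedComponent, c.supp.ncard := by
    rw [Nat.card_eq_fintype_card, ← Finset.card_univ,
      Finset.card_eq_sum_card_fiberwise (f := G.connectedComponentMk) (t := Finset.univ)
        (fun _ _ => Finset.mem_univ _)]
    refine Finset.sum_congr rfl fun c _ => ?_
    rw [← Set.ncard_coe_finset]
    congr 1
    ext v
    simp [SimpleGraph.ConnectedComponent.mem_supp_iff]
  let X : G.ConnectedComponent → Set (Sym2 V) := fun c => {e ∈ G.edgeSet | ∀ v ∈ e, v ∈ c.supp}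
  have hX : ∑ c, (X c).ncard ≤ G.edgeSet.ncard := by
    rw [← finsum_eq_sum_of_fintype, ← Set.ncard_iUnion_of_finite]
    · exact Set.ncard_le_ncard (Set.iUnion_subset fun c e he => he.1) (Set.toFinite _)
    · exact fun _ => Set.toFinite _
    · intro c c' hcc
      refine Set.disjoint_left.2 fun e he he' => hcc ?_
      induction e with
      | _ x y =>
        have h1 := he.2 x (Sym2.mem_mk_left _ _)
        have h2 := he'.2 x (Sym2.mem_mk_left _ _)
        rw [SimpleGraph.ConnectedComponent.mem_supp_iff] at h1 h2
        exact h1.symm.trans h2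
  have hc : ∀ c : G.ConnectedComponent, c.supp.ncard ≤ (X c).ncard + 1 := by
    intro c
    have := G.ncard_image_le_ncard_edges_add_one c.supp
      c.connected_toSimpleGraph.preconnected id
    rw [Set.image_id] at this
    refine this.trans (Nat.add_le_add_right (Set.ncard_le_ncard ?_ (Set.toFinite _)) 1)
    exact fun e he => ⟨he.1, he.2.1⟩
  calc Nat.card V = ∑ c : G.ConnectedComponent, c.supp.ncard := hV
    _ ≤ ∑ c, ((X c).ncard + 1) := Finset.sum_le_sum fun c _ => hc c
    _ = ∑ c, (X c).ncard + Nat.card G.ConnectedComponent := by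
      simp [Finset.sum_add_distrib, Nat.card_eq_fintype_card]
    _ ≤ _ := Nat.add_le_add_right hX _

/-- The double count behind the inequality. `κ` stands for the components of the sets `A_σ` with
`|σ| = k + 1`, labelled by `σ`, and `ι` for those of the sets `A_τ` with `|τ| = k`, labelled
by `τ`; `inc c d` says that `c` lies in `d`. -/
theorem mul_ncard_range_label_le {κ ι α : Type*} [Finite κ] [Finite ι] [DecidableEq α]
    (k : ℕ) (Q : SimpleGraph κ) (σ : κ → Finset α) (τ : ι → Finset α) (inc : κ → ι → Prop)
    (hE : Q.edgeSet.ncard ≤ 3 * Nat.card κ)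
    (hconn : ∀ d, (Q.induce {c | inc c d}).Preconnected)
    (hsub : ∀ c d, inc c d → τ d ⊆ σ c)
    (hσ : ∀ c, (σ c).card = k + 1) (hτ : ∀ d, (τ d).card = k)
    (hex : ∀ c, ∀ j ∈ σ c, ∃ d, inc c d ∧ τ d = (σ c).erase j)
    (huniq : ∀ c d d', inc c d → inc c d' → τ d = τ d' → d = d') :
    k * (Set.range σ).ncard ≤ 2 * Nat.card κ + Nat.card ι := by
  classical
  have := Fintype.ofFinite κ
  have := Fintype.ofFinite ι
  -- the edges joining components with the same label
  let S : SimpleGraph κ :=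
    { Adj := fun a b => Q.Adj a b ∧ σ a = σ b
      symm := ⟨fun a b h => ⟨h.1.symm, h.2.symm⟩⟩
      loopless := ⟨fun a h => Q.loopless.irrefl a h.1⟩ }
  have := Fintype.ofFinite S.ConnectedComponent
  have hSσ : ∀ a b, S.connectedComponentMk a = S.connectedComponentMk b → σ a = σ b := by
    intro a b h
    obtain ⟨p⟩ := SimpleGraph.ConnectedComponent.exact h
    clear h
    induction p with
    | nil => rfl
    | cons hs p ih => exact hs.2.trans ih
  let X : Set (Sym2 κ) := {e ∈ Q.edgeSet | ¬ (Sym2.map σ e).IsDiag}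
  let Y : ι → Set (Sym2 κ) := fun d => {e ∈ X | ∀ c ∈ e, inc c d}
  let I : ι → Set S.ConnectedComponent := fun d => S.connectedComponentMk '' {c | inc c d}
  have hI : ∀ d, (I d).ncard ≤ (Y d).ncard + 1 := by
    intro d
    refine (Q.ncard_image_le_ncard_edges_add_one _ (hconn d) S.connectedComponentMk).trans
      (Nat.add_le_add_right (Set.ncard_le_ncard ?_ (Set.toFinite _)) 1)
    intro e he
    induction e with
    | _ x y =>
      refine ⟨⟨he.1, fun h => he.2.2 ?_⟩, he.2.1⟩
      rw [Sym2.map_mk, Sym2.mk_isDiag_iff] at h ⊢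
      exact SimpleGraph.ConnectedComponent.sound (SimpleGraph.Adj.reachable ⟨he.1, h⟩)
  -- an edge with distinct labels lies in at most one `d`, whose label is the intersection of the two
  have hY : ∑ d, (Y d).ncard ≤ X.ncard := by
    rw [← finsum_eq_sum_of_fintype, ← Set.ncard_iUnion_of_finite]
    · exact Set.ncard_le_ncard (Set.iUnion_subset fun c e he => he.1) (Set.toFinite _)
    · exact fun _ => Set.toFinite _
    · intro d d' hdd
      refine Set.disjoint_left.2 fun e he he' => hdd ?_
      induction e with
      | _ x y =>
        have hne : σ x ≠ σ y := by
          have := he.1.2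
          rwa [Sym2.map_mk, Sym2.mk_isDiag_iff] at this
        have hlt : (σ x ∩ σ y).card ≤ k := by
          have h1 : σ x ∩ σ y ⊂ σ x := by
            refine Finset.ssubset_iff_subset_ne.2 ⟨Finset.inter_subset_left, fun h => hne ?_⟩
            refine Finset.eq_of_subset_of_card_le (Finset.inter_eq_left.1 h) ?_
            rw [hσ, hσ]
          have := Finset.card_lt_card h1
          rw [hσ] at this
          omega
        have key : ∀ d, s(x, y) ∈ Y d → τ d = σ x ∩ σ y := fun d hd =>
          Finset.eq_of_subset_of_card_le
            (Finset.subset_inter (hsub _ _ (hd.2 x (Sym2.mem_mk_left _ _)))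
              (hsub _ _ (hd.2 y (Sym2.mem_mk_right _ _)))) (by rw [hτ]; exact hlt)
        exact huniq x d d' (he.2 x (Sym2.mem_mk_left _ _)) (he'.2 x (Sym2.mem_mk_left _ _))
          ((key d he).trans (key d' he').symm)
  have hXS : X.ncard + S.edgeSet.ncard ≤ Q.edgeSet.ncard := by
    rw [← Set.ncard_union_eq ?_ (Set.toFinite _) (Set.toFinite _)]
    · refine Set.ncard_le_ncard ?_ (Set.toFinite _)
      rintro e (he | he)
      · exact he.1
      · induction e with
        | _ x y => exact he.1
    · refine Set.disjoint_left.2 fun e he he' => ?_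
      induction e with
      | _ x y => exact he.2 (by rw [Sym2.map_mk, Sym2.mk_isDiag_iff]; exact he'.2)
  have hScard := S.card_le_ncard_edgeSet_add_card_connectedComponent
  -- each class of components with label `σ` meets some `d` with label `τ`, for each `τ` below `σ`
  have hcount : (k + 1) * Nat.card S.ConnectedComponent ≤ ∑ d, (I d).ncard := by
    have h1 : ∑ d, (I d).ncard
        = ∑ q, (Finset.bipartiteBelow (fun d q => q ∈ I d) Finset.univ q).card := by
      rw [← Finset.sum_card_bipartiteAbove_eq_sum_card_bipartiteBelow (fun d q => q ∈ I d)]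
      refine Finset.sum_congr rfl fun d _ => ?_
      rw [← Set.ncard_coe_finset]
      congr 1
      ext q
      simp [Finset.bipartiteAbove]
    rw [h1, Nat.card_eq_fintype_card, mul_comm, ← smul_eq_mul, ← Finset.card_univ]
    refine Finset.card_nsmul_le_sum _ _ _ fun q _ => ?_
    induction q using SimpleGraph.ConnectedComponent.ind with
    | _ c =>
      obtain ⟨j₀, hj₀⟩ : (σ c).Nonempty := Finset.card_pos.1 (by rw [hσ]; omega)
      have : Nonempty ι := ⟨(hex c j₀ hj₀).choose⟩
      choose! g hg using hex c
      rw [← hσ c]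
      refine Finset.card_le_card_of_injOn g (fun j hj => ?_) fun i hi j hj hij => ?_
      · simpa [Finset.bipartiteBelow] using ⟨c, (hg j hj).1, rfl⟩
      · have h2 := (hg i hi).2
        rw [hij, (hg j hj).2] at h2
        by_contra hne
        have : i ∈ (σ c).erase j := Finset.mem_erase.2 ⟨hne, hi⟩
        rw [h2] at this
        simp at this
  have hrange : (Set.range σ).ncard ≤ Nat.card S.ConnectedComponent := by
    have : Set.range σ = Set.range
        (fun q : S.ConnectedComponent => σ q.out) := by
      ext s
      constructor
      · rintro ⟨c, rfl⟩
        exact ⟨S.connectedComponentMk c, hSσ _ _ (Quot.out_eq _)⟩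
      · rintro ⟨q, rfl⟩
        exact ⟨_, rfl⟩
    rw [this, ← Set.image_univ, ← Set.ncard_univ]
    exact Set.ncard_image_le (Set.toFinite _)
  have hsum : ∑ d, (I d).ncard ≤ ∑ d, (Y d).ncard + Nat.card ι := by
    refine (Finset.sum_le_sum fun d _ => hI d).trans ?_
    simp [Finset.sum_add_distrib, Nat.card_eq_fintype_card]
  calc k * (Set.range σ).ncard ≤ k * Nat.card S.ConnectedComponent :=
        Nat.mul_le_mul_left k hrange
    _ ≤ _ := by
      rw [add_mul] at hcount
      omega

/-! ### Mod 2 cycles in the square lattice -/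

/-- An edge of the square lattice `ℤ × ℤ`: `(v, false)` is the horizontal edge from `v` to
`v + (1, 0)` and `(v, true)` the vertical one from `v` to `v + (0, 1)`. -/
abbrev GridEdge : Type := (ℤ × ℤ) × Bool

namespace GridEdge

/-- The lower or left end of a lattice edge. -/
def src (g : GridEdge) : ℤ × ℤ := g.1

/-- The upper or right end of a lattice edge. -/
def tgt (g : GridEdge) : ℤ × ℤ := if g.2 then (g.1.1, g.1.2 + 1) else (g.1.1 + 1, g.1.2)

/-- One of the two unit squares at a lattice edge, squares being named by their lower left corner.
The other one is named by `g.1`. -/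
def face (g : GridEdge) : ℤ × ℤ := if g.2 then (g.1.1 - 1, g.1.2) else (g.1.1, g.1.2 - 1)

/-- The mod 2 boundary map from finite sets of lattice edges to finite sets of lattice points. -/
noncomputable def boundary : (GridEdge →₀ ZMod 2) →ₗ[ZMod 2] (ℤ × ℤ →₀ ZMod 2) :=
  Finsupp.linearCombination (ZMod 2) fun g => Finsupp.single g.src 1 + Finsupp.single g.tgt 1

theorem boundary_single (g : GridEdge) :
    boundary (Finsupp.single g 1) = Finsupp.single g.src 1 + Finsupp.single g.tgt 1 := by
  simp [boundary]

theorem boundary_apply (c : GridEdge →₀ ZMod 2) (i j : ℤ) :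
    boundary c (i, j) =
      c ((i, j), false) + c ((i, j), true) + c ((i - 1, j), false) + c ((i, j - 1), true) := by
  induction c using Finsupp.induction_linear with
  | zero => simp
  | add f g hf hg => rw [map_add, Finsupp.add_apply, hf, hg]; simp only [Finsupp.add_apply]; ring
  | single g r =>
    obtain ⟨⟨x, y⟩, d⟩ := g
    cases d <;>
    simp only [boundary, Finsupp.linearCombination_single, src, tgt, Finsupp.smul_apply,
      Finsupp.add_apply, Finsupp.single_apply, Prod.mk.injEq, smul_eq_mul, Bool.false_eq_true,
      if_false, if_true, and_false, and_true, add_zero, zero_add,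
      reduceCtorEq, eq_sub_iff_add_eq] <;> split_ifs <;> first | (exfalso; omega) | simp

/-- The boundary of a set of squares has no boundary. -/
theorem boundary_eq_zero_of_eq_face_add (c : GridEdge →₀ ZMod 2) (φ : ℤ × ℤ → ZMod 2)
    (h : ∀ g : GridEdge, c g = φ g.1 + φ g.face) : boundary c = 0 := by
  ext ⟨i, j⟩
  rw [boundary_apply]
  simp only [h, face, Bool.false_eq_true, if_false, if_true, Finsupp.coe_zero, Pi.zero_apply]
  generalize φ (i, j) = p
  generalize φ (i, j - 1) = q
  generalize φ (i - 1, j) = r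
  generalize φ (i - 1, j - 1) = s
  revert p q r s
  decide

/-- The plane is simply connected: a finite mod 2 cycle in the lattice is the boundary of a set of
squares. The square `(i, j)` belongs to it when an upward ray from it crosses the cycle an odd
number of times. -/
theorem exists_eq_face_add (c : GridEdge →₀ ZMod 2) (hc : boundary c = 0) :
    ∃ φ : ℤ × ℤ → ZMod 2, ∀ g : GridEdge, c g = φ g.1 + φ g.face := by
  classical
  obtain ⟨N, hN⟩ : ∃ N : ℤ, ∀ g : GridEdge, N < g.1.2 → c g = 0 := by
    obtain ⟨N, hN⟩ := (c.support.image fun g : GridEdge => g.1.2).bddAbove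
    refine ⟨N, fun g hg => ?_⟩
    by_contra hne
    exact absurd (hN (Finset.mem_coe.2 (Finset.mem_image_of_mem _ (Finsupp.mem_support_iff.2 hne))))
      (not_le.2 hg)
  have hcyc : ∀ i j, c ((i, j), false) + c ((i, j), true) + c ((i - 1, j), false)
      + c ((i, j - 1), true) = 0 := fun i j => by rw [← boundary_apply, hc]; rfl
  have hstep : ∀ (f : ℤ → ZMod 2) (j : ℤ), (N < j → f j = 0) →
      ∑ m ∈ Finset.Ioc (j - 1) N, f m = f j + ∑ m ∈ Finset.Ioc j N, f m := by
    intro f j hf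
    by_cases hj : j ≤ N
    · have : Finset.Ioc (j - 1) N = insert j (Finset.Ioc j N) := by
        ext m; simp only [Finset.mem_Ioc, Finset.mem_insert]; omega
      rw [this, Finset.sum_insert (by simp)]
    · rw [hf (by omega), Finset.Ioc_eq_empty (by omega), Finset.Ioc_eq_empty (by omega)]
      simp
  refine ⟨fun v => ∑ m ∈ Finset.Ioc v.2 N, c ((v.1, m), false), ?_⟩
  rintro ⟨⟨i, j⟩, d⟩
  cases d
  · simp only [face, Bool.false_eq_true, if_false]
    rw [hstep (fun m => c ((i, m), false)) j (fun h => hN _ h)]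
    linear_combination -(CharTwo.add_self_eq_zero (∑ m ∈ Finset.Ioc j N, c ((i, m), false)))
  · simp only [face, if_true]
    have key : ∀ n : ℕ, ∀ j : ℤ, N - j ≤ n → c ((i, j), true) =
        ∑ m ∈ Finset.Ioc j N, c ((i, m), false) + ∑ m ∈ Finset.Ioc j N, c ((i - 1, m), false) := by
      intro n
      induction n with
      | zero =>
        intro j hj
        have h1 := hcyc i (j + 1)
        rw [hN ((i, j + 1), false) (by simp; omega), hN ((i, j + 1), true) (by simp; omega),
          hN ((i - 1, j + 1), false) (by simp; omega)] at h1
        rw [Finset.Ioc_eq_empty (by omega)]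
        simpa using h1
      | succ n ih =>
        intro j hj
        have h1 := hcyc i (j + 1)
        have h2 := ih (j + 1) (by push_cast at hj; omega)
        have h3 := hstep (fun m => c ((i, m), false)) (j + 1) (fun h => hN _ h)
        have h4 := hstep (fun m => c ((i - 1, m), false)) (j + 1) (fun h => hN _ h)
        simp only [add_sub_cancel_right] at h1 h3 h4
        rw [h3, h4]
        linear_combination h1 - h2 -
          CharTwo.add_self_eq_zero (c ((i, j + 1), false) + c ((i - 1, j + 1), false)
          + ∑ m ∈ Finset.Ioc (j + 1) N, c ((i, m), false)
          + ∑ m ∈ Finset.Ioc (j + 1) N, c ((i - 1, m), false))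
    exact key (N - j).toNat j (by omega)

end GridEdge

/-- Adjacency in the square lattice. -/
def GridAdj (u w : ℤ × ℤ) : Prop :=
  ∃ g : GridEdge, (g.src = u ∧ g.tgt = w) ∨ (g.src = w ∧ g.tgt = u)

theorem GridAdj.symm {u w : ℤ × ℤ} (h : GridAdj u w) : GridAdj w u := by
  obtain ⟨g, h⟩ := h
  exact ⟨g, h.symm⟩

/-- A set of lattice points is connected (or empty): a set that meets it and is closed under passing
to lattice neighbours within it contains it. -/
def GridConnected (S : Set (ℤ × ℤ)) : Prop :=
  ∀ A : Set (ℤ × ℤ), (A ∩ S).Nonempty → (∀ u ∈ A ∩ S, ∀ w ∈ S, GridAdj u w → w ∈ A) → S ⊆ A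

theorem GridConnected.exists_chain {S : Set (ℤ × ℤ)} (hS : GridConnected S) {p u : ℤ × ℤ}
    (hp : p ∈ S) (hu : u ∈ S) :
    ∃ c : GridEdge →₀ ZMod 2, GridEdge.boundary c = Finsupp.single p 1 + Finsupp.single u 1 ∧
      ∀ g : GridEdge, c g ≠ 0 → g.src ∈ S ∧ g.tgt ∈ S := by
  refine hS {u | ∃ c : GridEdge →₀ ZMod 2,
    GridEdge.boundary c = Finsupp.single p 1 + Finsupp.single u 1 ∧
      ∀ g : GridEdge, c g ≠ 0 → g.src ∈ S ∧ g.tgt ∈ S} ⟨p, ⟨0, ?_, ?_⟩, hp⟩ ?_ hu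
  · rw [map_zero, ← Finsupp.single_add, CharTwo.add_self_eq_zero, Finsupp.single_zero]
  · simp
  · rintro v ⟨⟨c, hc, hcS⟩, hv⟩ w hw ⟨g, hg⟩
    refine ⟨c + Finsupp.single g 1, ?_, ?_⟩
    · rw [map_add, hc, GridEdge.boundary_single]
      have h2 : Finsupp.single v (1 : ZMod 2) + Finsupp.single v 1 = 0 := by
        rw [← Finsupp.single_add, CharTwo.add_self_eq_zero, Finsupp.single_zero]
      have h3 : ∀ x : ℤ × ℤ →₀ ZMod 2,
          x + Finsupp.single v 1 + (Finsupp.single v 1 + Finsupp.single w 1)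
            = x + Finsupp.single w 1 := by
        intro x
        rw [add_assoc, ← add_assoc (Finsupp.single v 1), h2, zero_add]
      rcases hg with ⟨h, h'⟩ | ⟨h, h'⟩ <;> rw [h, h']
      · exact h3 _
      · rw [add_comm (Finsupp.single w _)]
        exact h3 _
    · intro g' hg'
      by_cases hgg : g' = g
      · subst hgg
        rcases hg with ⟨h, h'⟩ | ⟨h, h'⟩ <;> rw [h, h'] <;> exact ⟨by assumption, by assumption⟩
      · refine hcS g' fun h => hg' ?_
        rw [Finsupp.add_apply, h, Finsupp.single_apply, if_neg (Ne.symm hgg), add_zero]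

/-! ### Planar graphs have few edges -/

/-- The mod 2 boundary map of the multigraph on `κ` whose edge `e` joins `a e` and `b e`. -/
noncomputable def graphBoundary {E κ : Type*} [Fintype E] [DecidableEq κ] (a b : E → κ) :
    (E → ZMod 2) →ₗ[ZMod 2] (κ → ZMod 2) :=
  Fintype.linearCombination (ZMod 2) fun e => Pi.single (a e) 1 + Pi.single (b e) 1

/-- A nonempty cycle of a simple graph has at least three edges. -/
theorem three_le_card_support_of_graphBoundary_eq_zero {E κ : Type*} [Fintype E] [DecidableEq E]
    [DecidableEq κ] (a b : E → κ) (hab : ∀ e, a e ≠ b e)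
    (hinj : Function.Injective fun e => s(a e, b e)) (z : E → ZMod 2)
    (hz : graphBoundary a b z = 0) (hne : z ≠ 0) : 3 ≤ (Finset.univ.filter (z · ≠ 0)).card := by
  have hzC : ∀ C, ∑ e, z e * ((if C = a e then 1 else 0) + (if C = b e then 1 else 0)) = 0 := by
    intro C
    have := congrFun hz C
    simpa [graphBoundary, Fintype.linearCombination_apply, Finset.sum_apply, Pi.single_apply,
      mul_add] using this
  -- a cycle passing through an edge leaves its ends by other edges
  have hother : ∀ e C, z e ≠ 0 → (C = a e ∨ C = b e) →
      ∃ e', e' ≠ e ∧ z e' ≠ 0 ∧ (C = a e' ∨ C = b e') := by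
    intro e C he hC
    by_contra! hno
    have := hzC C
    rw [Finset.sum_eq_single e] at this
    · have hone : ((if C = a e then 1 else 0) + (if C = b e then 1 else 0) : ZMod 2) = 1 := by
        rcases hC with rfl | rfl
        · simp [hab e]
        · simp [(hab e).symm]
      rw [hone, mul_one] at this
      exact he this
    · intro e' _ he'
      by_cases hz' : z e' = 0
      · simp [hz']
      · have := hno e' he' hz'
        simp [this.1, this.2]
    · simp
  obtain ⟨e, he⟩ := Function.ne_iff.1 hne
  obtain ⟨e₁, h1, hz1, hC1⟩ := hother e (a e) he (Or.inl rfl)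
  obtain ⟨e₂, h2, hz2, hC2⟩ := hother e (b e) he (Or.inr rfl)
  have h12 : e₁ ≠ e₂ := by
    rintro rfl
    refine h1 (hinj ?_)
    have := hab e
    rcases hC1 with h | h <;> rcases hC2 with h' | h' <;> simp_all
  have : ({e, e₁, e₂} : Finset E) ⊆ Finset.univ.filter (z · ≠ 0) := by
    intro x hx
    simp only [Finset.mem_insert, Finset.mem_singleton] at hx
    rcases hx with rfl | rfl | rfl <;> simpa
  refine le_trans (le_of_eq ?_) (Finset.card_le_card this)
  rw [Finset.card_insert_of_notMem (by simp [h1.symm, h2.symm]), Finset.card_pair h12]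

/-- If the cycles of a simple graph are spanned by vectors `s K`, themselves cycles, such that the
edge `e` occurs in no `s K` other than `K = L e` and `K = R e`, then the graph has at most three
times as many edges as vertices. -/
theorem card_edges_le_of_cycles_le_span {E κ 𝒦 : Type*} [Fintype E] [Fintype κ] [DecidableEq κ]
    (a b : E → κ) (hab : ∀ e, a e ≠ b e) (hinj : Function.Injective fun e => s(a e, b e))
    (s : 𝒦 → E → ZMod 2) (L R : E → 𝒦) (hs : ∀ K, graphBoundary a b (s K) = 0)
    (hLR : ∀ K e, s K e ≠ 0 → K = L e ∨ K = R e)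
    (hspan : LinearMap.ker (graphBoundary a b) ≤ Submodule.span (ZMod 2) (Set.range s)) :
    Fintype.card E ≤ 3 * Fintype.card κ := by
  classical
  let F : Finset 𝒦 :=
    (Finset.univ.image L ∪ Finset.univ.image R).filter fun K => s K ≠ 0
  have hmem : ∀ K e, s K e ≠ 0 → K ∈ F := by
    intro K e h
    refine Finset.mem_filter.2 ⟨?_, fun h0 => h (by rw [h0]; rfl)⟩
    rcases hLR K e h with rfl | rfl <;> simp
  have hker : Module.finrank (ZMod 2) (LinearMap.ker (graphBoundary a b)) ≤ F.card := by
    have h1 : LinearMap.ker (graphBoundary a b) ≤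
        Submodule.span (ZMod 2) ((F.image s : Finset (E → ZMod 2)) : Set (E → ZMod 2)) := by
      refine hspan.trans (Submodule.span_le.2 ?_)
      rintro _ ⟨K, rfl⟩
      by_cases h0 : s K = 0
      · rw [h0]; exact Submodule.zero_mem _
      · obtain ⟨e, he⟩ := Function.ne_iff.1 h0
        exact Submodule.subset_span (Finset.mem_coe.2 (Finset.mem_image_of_mem _ (hmem K e he)))
    exact (Submodule.finrank_mono h1).trans
      ((finrank_span_finset_le_card _).trans Finset.card_image_le)
  have hrank : Fintype.card E ≤ Fintype.card κ + F.card := by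
    have h1 := LinearMap.finrank_range_add_finrank_ker (graphBoundary a b)
    have h2 := Submodule.finrank_le (LinearMap.range (graphBoundary a b))
    rw [Module.finrank_pi] at h1 h2
    omega
  have hdouble : 3 * F.card ≤ 2 * Fintype.card E := by
    have h1 : F.card * 3 ≤ ∑ K ∈ F, (Finset.univ.filter (s K · ≠ 0)).card := by
      rw [← smul_eq_mul]
      refine Finset.card_nsmul_le_sum _ _ _ fun K hK => ?_
      exact three_le_card_support_of_graphBoundary_eq_zero a b hab hinj _ (hs K)
        (Finset.mem_filter.1 hK).2
    have h2 : ∑ K ∈ F, (Finset.univ.filter (s K · ≠ 0)).card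
        = ∑ e, (F.filter (s · e ≠ 0)).card :=
      Finset.sum_card_bipartiteAbove_eq_sum_card_bipartiteBelow fun K e => s K e ≠ 0
    have h3 : ∑ e, (F.filter (s · e ≠ 0)).card ≤ Fintype.card E * 2 := by
      rw [← smul_eq_mul, ← Finset.card_univ]
      refine Finset.sum_le_card_nsmul _ _ _ fun e _ => ?_
      refine (Finset.card_le_card (t := {L e, R e}) ?_).trans Finset.card_le_two
      intro K hK
      simpa using hLR K e (Finset.mem_filter.1 hK).2
    omega
  omega

/-- A simple graph obtained from the square lattice by contracting disjoint connected sets `S C`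
(and deleting edges) has at most three times as many edges as vertices. -/
theorem card_edges_le_of_grid_minor {E κ : Type*} [Fintype E] [Fintype κ]
    (a b : E → κ) (hab : ∀ e, a e ≠ b e) (hinj : Function.Injective fun e => s(a e, b e))
    (S : κ → Set (ℤ × ℤ)) (hconn : ∀ C, GridConnected (S C))
    (hdisj : ∀ C C', C ≠ C' → Disjoint (S C) (S C'))
    (g : E → GridEdge) (hsrc : ∀ e, (g e).src ∈ S (a e)) (htgt : ∀ e, (g e).tgt ∈ S (b e)) :
    Fintype.card E ≤ 3 * Fintype.card κ := by
  classical
  have huniq : ∀ {C C' v}, v ∈ S C → v ∈ S C' → C = C' := by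
    intro C C' v h h'
    by_contra hne
    exact Set.disjoint_left.1 (hdisj C C' hne) h h'
  have hg : Function.Injective g := by
    intro e e' h
    have h1 : a e = a e' := huniq (hsrc e) (h ▸ hsrc e')
    have h2 : b e = b e' := huniq (htgt e) (h ▸ htgt e')
    exact hinj (by simp only [h1, h2])
  let p : κ → ℤ × ℤ := fun C => if h : (S C).Nonempty then h.some else 0
  have hp : ∀ {C v}, v ∈ S C → p C ∈ S C := by
    intro C v hv
    have h : (S C).Nonempty := ⟨v, hv⟩
    simp only [p, dif_pos h]
    exact h.some_mem
  -- lift every edge to a lattice chain joining the base points of the two contracted sets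
  have hchain : ∀ e, ∃ c : GridEdge →₀ ZMod 2,
      GridEdge.boundary c = Finsupp.single (p (a e)) 1 + Finsupp.single (p (b e)) 1 ∧
      (∀ e', c (g e') = if e' = e then 1 else 0) ∧
      ∀ γ : GridEdge, c γ ≠ 0 → γ = g e ∨ ∃ C, γ.src ∈ S C ∧ γ.tgt ∈ S C := by
    intro e
    obtain ⟨c₁, h1, hs1⟩ := (hconn (a e)).exists_chain (hp (hsrc e)) (hsrc e)
    obtain ⟨c₂, h2, hs2⟩ := (hconn (b e)).exists_chain (hp (htgt e)) (htgt e)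
    have hzero : ∀ (c : GridEdge →₀ ZMod 2) (C : κ),
        (∀ γ : GridEdge, c γ ≠ 0 → γ.src ∈ S C ∧ γ.tgt ∈ S C) → ∀ e', c (g e') = 0 := by
      intro c C hc e'
      by_contra h
      have := hc _ h
      exact hab e' ((huniq (hsrc e') this.1).trans (huniq (htgt e') this.2).symm)
    refine ⟨c₁ + Finsupp.single (g e) 1 + c₂, ?_, ?_, ?_⟩
    · rw [map_add, map_add, h1, h2, GridEdge.boundary_single]
      have hd : ∀ v : ℤ × ℤ, Finsupp.single v (1 : ZMod 2) + Finsupp.single v 1 = 0 := fun v => by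
        rw [← Finsupp.single_add, CharTwo.add_self_eq_zero, Finsupp.single_zero]
      calc _ = Finsupp.single (p (a e)) 1 + Finsupp.single (p (b e)) 1
            + (Finsupp.single (g e).src 1 + Finsupp.single (g e).src 1)
            + (Finsupp.single (g e).tgt 1 + Finsupp.single (g e).tgt (1 : ZMod 2)) := by abel
        _ = _ := by rw [hd, hd, add_zero, add_zero]
    · intro e'
      rw [Finsupp.add_apply, Finsupp.add_apply, hzero _ _ hs1, hzero _ _ hs2, zero_add, add_zero,
        Finsupp.single_apply]
      simp only [hg.eq_iff, eq_comm]
    · intro γ hγ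
      by_cases hγe : γ = g e
      · exact Or.inl hγe
      · right
        rw [Finsupp.add_apply, Finsupp.add_apply, Finsupp.single_apply, if_neg (Ne.symm hγe),
          add_zero] at hγ
        by_cases h : c₁ γ = 0
        · rw [h, zero_add] at hγ
          exact ⟨_, hs2 γ hγ⟩
        · exact ⟨_, hs1 γ h⟩
  choose c hcb hcg hcs using hchain
  -- the lattice edges used, and the regions into which they divide the squares
  let H : Finset GridEdge := Finset.univ.biUnion fun e => (c e).support
  have hH : ∀ γ ∈ H, (∃ e, γ = g e) ∨ ∃ C, γ.src ∈ S C ∧ γ.tgt ∈ S C := by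
    intro γ hγ
    obtain ⟨e, -, he⟩ := Finset.mem_biUnion.1 hγ
    rcases hcs e γ (Finsupp.mem_support_iff.1 he) with h | h
    · exact Or.inl ⟨e, h⟩
    · exact Or.inr h
  let r : ℤ × ℤ → ℤ × ℤ → Prop := fun f f' => ∃ γ : GridEdge, γ ∉ H ∧ f = γ.1 ∧ f' = γ.face
  let L : E → Quot r := fun e => Quot.mk r (g e).1
  let R : E → Quot r := fun e => Quot.mk r (g e).face
  let s : Quot r → E → ZMod 2 := fun K e =>
    (if K = L e then 1 else 0) + (if K = R e then 1 else 0)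
  refine card_edges_le_of_cycles_le_span a b hab hinj s L R ?_ ?_ ?_
  · -- the boundary of a region is a lattice cycle, and contracting it gives a cycle
    intro K
    let φ : ℤ × ℤ → ZMod 2 := fun f => if K = Quot.mk r f then 1 else 0
    have hφ : ∀ γ : GridEdge, φ γ.1 + φ γ.face ≠ 0 → γ ∈ H := by
      intro γ h
      by_contra hγ
      have : Quot.mk r γ.1 = Quot.mk r γ.face := Quot.sound ⟨γ, hγ, rfl, rfl⟩
      apply h
      simp only [φ, this]
      exact CharTwo.add_self_eq_zero _
    let d : GridEdge →₀ ZMod 2 := Finsupp.onFinset H (fun γ => φ γ.1 + φ γ.face) hφ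
    have hd : GridEdge.boundary d = 0 :=
      GridEdge.boundary_eq_zero_of_eq_face_add d φ fun γ => Finsupp.onFinset_apply
    let ℓ : ℤ × ℤ → κ → ZMod 2 := fun v C => if v ∈ S C then 1 else 0
    have hℓ : ∀ {v C}, v ∈ S C → ℓ v = Pi.single C 1 := by
      intro v C hv
      ext C'
      rw [Pi.single_apply]
      by_cases h : C' = C
      · subst h; simp [ℓ, hv]
      · simp only [ℓ, if_neg h, if_neg (fun hv' : v ∈ S C' => h (huniq hv' hv))]
    have hdH : GridEdge.boundary d =
        ∑ γ ∈ H, d γ • (Finsupp.single γ.src 1 + Finsupp.single γ.tgt 1) := by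
      rw [GridEdge.boundary, Finsupp.linearCombination_apply]
      exact Finsupp.sum_of_support_subset d Finsupp.support_onFinset_subset _ (by simp)
    have h0 := congrArg (Finsupp.linearCombination (ZMod 2) ℓ) hd
    rw [map_zero, hdH, map_sum] at h0
    rw [← h0, graphBoundary, Fintype.linearCombination_apply]
    have hF : ∀ γ, Finsupp.linearCombination (ZMod 2) ℓ
        (d γ • (Finsupp.single γ.src 1 + Finsupp.single γ.tgt 1)) =
        d γ • (ℓ γ.src + ℓ γ.tgt) := by
      intro γ
      simp
    simp only [hF]
    refine (Finset.sum_of_injOn g hg.injOn ?_ ?_ ?_)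
    · intro e _
      refine Finset.mem_coe.2 (Finset.mem_biUnion.2 ⟨e, Finset.mem_univ _, ?_⟩)
      rw [Finsupp.mem_support_iff, hcg, if_pos rfl]
      exact one_ne_zero
    · intro γ hγ hγ'
      rcases hH γ hγ with ⟨e, rfl⟩ | ⟨C, h, h'⟩
      · exact absurd ⟨e, by simp, rfl⟩ hγ'
      · rw [hℓ h, hℓ h']
        ext C'
        simp [CharTwo.add_self_eq_zero]
    · intro e _
      rw [hℓ (hsrc e), hℓ (htgt e)]
      rfl
  · intro K e h
    by_contra! hne
    exact h (by simp [s, hne.1, hne.2])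
  · -- a cycle lifts to a lattice cycle, which bounds a set of squares, a union of regions
    intro z hz
    let d : GridEdge →₀ ZMod 2 := ∑ e, z e • c e
    have hd : GridEdge.boundary d = 0 := by
      have hzE : graphBoundary a b z = ∑ e, z e • (Pi.single (a e) 1 + Pi.single (b e) 1) :=
        Fintype.linearCombination_apply _ _ _
      have hz' := congrArg (Fintype.linearCombination (ZMod 2)
        fun C => (Finsupp.single (p C) (1 : ZMod 2) : ℤ × ℤ →₀ ZMod 2)) (LinearMap.mem_ker.1 hz)
      rw [map_zero, hzE, map_sum] at hz'
      rw [map_sum, ← hz']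
      refine Finset.sum_congr rfl fun e _ => ?_
      rw [map_smul, map_smul, hcb, map_add, Fintype.linearCombination_apply_single,
        Fintype.linearCombination_apply_single, one_smul, one_smul]
    obtain ⟨φ, hφ⟩ := GridEdge.exists_eq_face_add d hd
    let h : Quot r → ZMod 2 := Quot.lift φ (by
      rintro _ _ ⟨γ, hγ, rfl, rfl⟩
      have h0 : d γ = 0 := by
        simp only [d, Finsupp.coe_finsetSum, Finset.sum_apply, Finsupp.smul_apply]
        refine Finset.sum_eq_zero fun e _ => ?_
        have : c e γ = 0 := by
          by_contra hne
          exact hγ (Finset.mem_biUnion.2 ⟨e, Finset.mem_univ _, Finsupp.mem_support_iff.2 hne⟩)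
        rw [this, smul_zero]
      rw [hφ] at h0
      exact CharTwo.add_eq_zero.1 h0)
    have hze : ∀ e, z e = h (L e) + h (R e) := by
      intro e
      have : d (g e) = z e := by
        simp [d, Finset.sum_apply, hcg]
      rw [← this, hφ]
    have hzs : z = ∑ K ∈ Finset.univ.image L ∪ Finset.univ.image R, h K • s K := by
      ext e
      rw [hze, Finset.sum_apply]
      simp only [s, Pi.smul_apply, smul_eq_mul, mul_add, Finset.sum_add_distrib, mul_ite, mul_one,
        mul_zero, Finset.sum_ite_eq']
      rw [if_pos (by simp), if_pos (by simp)]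
    rw [hzs]
    exact Submodule.sum_mem _ fun K _ => Submodule.smul_mem _ _ (Submodule.subset_span ⟨K, rfl⟩)

/-! ### Graphs from connected sets of lattice points -/

theorem GridConnected.insert {S : Set (ℤ × ℤ)} (hS : GridConnected S) {u w : ℤ × ℤ} (hu : u ∈ S)
    (h : GridAdj u w) : GridConnected (insert w S) := by
  intro A hA hcl
  have hAS : (A ∩ S).Nonempty := by
    obtain ⟨v, hvA, rfl | hv⟩ := hA
    · exact ⟨u, hcl v ⟨hvA, Or.inl rfl⟩ u (Or.inr hu) h.symm, hu⟩
    · exact ⟨v, hvA, hv⟩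
  have hSA : S ⊆ A := hS A hAS fun v hv x hx => hcl v ⟨hv.1, Or.inr hv.2⟩ x (Or.inr hx)
  exact Set.insert_subset (hcl u ⟨hSA hu, Or.inr hu⟩ w (Or.inl rfl) h) hSA

/-- Disjoint connected sets `S c`, regarded as seeds, grow inside connected sets `T d` that overlap
only in the seeds until they cover all `T d`, and meet no further `T d` in doing so. -/
theorem exists_gridConnected_extension {κ ι : Type*} [Finite ι] (S : κ → Set (ℤ × ℤ))
    (T : ι → Set (ℤ × ℤ)) (hS : ∀ c, GridConnected (S c)) (hT : ∀ d, GridConnected (T d))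
    (hfin : ∀ d, (T d).Finite) (hdisj : ∀ c c', c ≠ c' → Disjoint (S c) (S c'))
    (hmeet : ∀ d, ∃ c, (S c ∩ T d).Nonempty)
    (hTT : ∀ d d', d ≠ d' → ∀ v ∈ T d ∩ T d', ∃ c, v ∈ S c) :
    ∃ S' : κ → Set (ℤ × ℤ), (∀ c, GridConnected (S' c)) ∧
      (∀ c c', c ≠ c' → Disjoint (S' c) (S' c')) ∧ (∀ c, S c ⊆ S' c) ∧
      (∀ c d, (S' c ∩ T d).Nonempty → (S c ∩ T d).Nonempty) ∧ ∀ d, ∀ v ∈ T d, ∃ c, v ∈ S' c := by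
  classical
  have hfinU : (⋃ d, T d).Finite := Set.finite_iUnion hfin
  suffices h : ∀ m : ℕ, ∀ S' : κ → Set (ℤ × ℤ), (∀ c, GridConnected (S' c)) →
      (∀ c c', c ≠ c' → Disjoint (S' c) (S' c')) → (∀ c, S c ⊆ S' c) →
      (∀ c d, (S' c ∩ T d).Nonempty → (S c ∩ T d).Nonempty) →
      ((⋃ d, T d) \ ⋃ c, S' c).ncard = m → ∃ S' : κ → Set (ℤ × ℤ), (∀ c, GridConnected (S' c)) ∧
      (∀ c c', c ≠ c' → Disjoint (S' c) (S' c')) ∧ (∀ c, S c ⊆ S' c) ∧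
      (∀ c d, (S' c ∩ T d).Nonempty → (S c ∩ T d).Nonempty) ∧ ∀ d, ∀ v ∈ T d, ∃ c, v ∈ S' c from
    h _ S hS hdisj (fun _ => subset_rfl) (fun _ _ h => h) rfl
  intro m
  induction m with
  | zero =>
    intro S' h1 h2 h3 h4 h5
    refine ⟨S', h1, h2, h3, h4, fun d v hv => ?_⟩
    rw [Set.ncard_eq_zero (hfinU.subset Set.sdiff_subset), Set.sdiff_eq_empty] at h5
    exact Set.mem_iUnion.1 (h5 (Set.mem_iUnion.2 ⟨d, hv⟩))
  | succ m ih =>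
    intro S' h1 h2 h3 h4 h5
    obtain ⟨v, hv, hvS⟩ : ((⋃ d, T d) \ ⋃ c, S' c).Nonempty := by
      rw [Set.nonempty_iff_ne_empty]
      intro h0
      rw [h0, Set.ncard_empty] at h5
      omega
    obtain ⟨d, hd⟩ := Set.mem_iUnion.1 hv
    -- somewhere in `T d` an uncovered point `w` is adjacent to a covered point `u`
    obtain ⟨u, hu, hud, w, hw, hwS, huw⟩ :
        ∃ u ∈ ⋃ c, S' c, u ∈ T d ∧ ∃ w ∈ T d, w ∉ ⋃ c, S' c ∧ GridAdj u w := by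
      by_contra! hno
      obtain ⟨c, x, hx, hxd⟩ := hmeet d
      exact hvS (hT d (⋃ c, S' c) ⟨x, Set.mem_iUnion.2 ⟨c, h3 c hx⟩, hxd⟩
        (fun u hu w hw h => by
          by_contra hwS
          exact hno u hu.1 hu.2 w hw hwS h) hd)
    obtain ⟨c, huc⟩ := Set.mem_iUnion.1 hu
    have hwd : ∀ d', w ∈ T d' → d' = d := by
      intro d' hd'
      by_contra hne
      obtain ⟨c', hc'⟩ := hTT d' d hne w ⟨hd', hw⟩
      exact hwS (Set.mem_iUnion.2 ⟨c', h3 c' hc'⟩)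
    have hwS' : ∀ c, w ∉ S' c := fun c h => hwS (Set.mem_iUnion.2 ⟨c, h⟩)
    refine ih (Function.update S' c (Set.insert w (S' c))) ?_ ?_ ?_ ?_ ?_
    · intro x
      by_cases hx : x = c
      · subst hx
        rw [Function.update_self]
        exact (h1 x).insert huc huw
      · rw [Function.update_of_ne hx]
        exact h1 x
    · have key : ∀ x, x ≠ c → Disjoint (Set.insert w (S' c)) (S' x) := fun x hx =>
        Set.disjoint_insert_left.2 ⟨hwS' x, h2 c x hx.symm⟩
      intro x y hxy
      by_cases hx : x = c
      · subst hx
        rw [Function.update_self, Function.update_of_ne hxy.symm]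
        exact key y hxy.symm
      · by_cases hy : y = c
        · subst hy
          rw [Function.update_self, Function.update_of_ne hx]
          exact (key x hx).symm
        · rw [Function.update_of_ne hx, Function.update_of_ne hy]
          exact h2 x y hxy
    · intro x
      by_cases hx : x = c
      · subst hx
        rw [Function.update_self]
        exact (h3 x).trans (Set.subset_insert _ _)
      · rw [Function.update_of_ne hx]
        exact h3 x
    · intro x d'
      by_cases hx : x = c
      · subst hx
        rw [Function.update_self]
        rintro ⟨y, rfl | hy, hyd⟩
        · rw [hwd d' hyd]
          exact h4 x d ⟨u, huc, hud⟩
        · exact h4 x d' ⟨y, hy, hyd⟩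
      · rw [Function.update_of_ne hx]
        exact h4 x d'
    · have hU : (⋃ d, T d) \ ⋃ x, Function.update S' c (Set.insert w (S' c)) x
          = ((⋃ d, T d) \ ⋃ c, S' c) \ {w} := by
        rw [Set.sdiff_sdiff]
        congr 1
        ext y
        simp only [Set.mem_iUnion, Set.mem_union, Set.mem_singleton_iff]
        constructor
        · rintro ⟨x, hx⟩
          by_cases hxc : x = c
          · subst hxc
            rw [Function.update_self] at hx
            rcases hx with rfl | hx
            · exact Or.inr rfl
            · exact Or.inl ⟨x, hx⟩
          · rw [Function.update_of_ne hxc] at hx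
            exact Or.inl ⟨x, hx⟩
        · rintro (⟨x, hx⟩ | rfl)
          · refine ⟨x, ?_⟩
            by_cases hxc : x = c
            · subst hxc
              rw [Function.update_self]
              exact Or.inr hx
            · rwa [Function.update_of_ne hxc]
          · refine ⟨c, ?_⟩
            rw [Function.update_self]
            exact Or.inl rfl
      have hwU : w ∈ (⋃ d, T d) \ ⋃ c, S' c := ⟨Set.mem_iUnion.2 ⟨d, hw⟩, hwS⟩
      rw [hU, Set.ncard_sdiff_singleton_of_mem hwU, h5]
      rfl

/-- The adjacencies between disjoint connected seeds, grown as in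
`exists_gridConnected_extension`, form a planar graph that is connected along every `T d`. -/
theorem exists_simpleGraph_of_grid {κ ι : Type*} [Finite κ] [Finite ι] (S : κ → Set (ℤ × ℤ))
    (T : ι → Set (ℤ × ℤ)) (hS : ∀ c, GridConnected (S c)) (hT : ∀ d, GridConnected (T d))
    (hfin : ∀ d, (T d).Finite) (hdisj : ∀ c c', c ≠ c' → Disjoint (S c) (S c'))
    (hmeet : ∀ d, ∃ c, (S c ∩ T d).Nonempty)
    (hTT : ∀ d d', d ≠ d' → ∀ v ∈ T d ∩ T d', ∃ c, v ∈ S c) :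
    ∃ Q : SimpleGraph κ, Q.edgeSet.ncard ≤ 3 * Nat.card κ ∧
      ∀ d, (Q.induce {c | (S c ∩ T d).Nonempty}).Preconnected := by
  classical
  have := Fintype.ofFinite κ
  obtain ⟨S', h1, h2, h3, h4, h5⟩ := exists_gridConnected_extension S T hS hT hfin hdisj hmeet hTT
  let Q : SimpleGraph κ :=
    { Adj := fun c c' => c ≠ c' ∧ ∃ u ∈ S' c, ∃ w ∈ S' c', GridAdj u w
      symm := ⟨fun c c' ⟨h, u, hu, w, hw, ha⟩ => ⟨h.symm, w, hw, u, hu, ha.symm⟩⟩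
      loopless := ⟨fun c h => h.1 rfl⟩ }
  refine ⟨Q, ?_, ?_⟩
  · have hch : ∀ e : Q.edgeSet, ∃ (a b : κ) (g : GridEdge), s(a, b) = e.1 ∧ a ≠ b ∧
        g.src ∈ S' a ∧ g.tgt ∈ S' b := by
      rintro ⟨e, he⟩
      induction e with
      | _ x y =>
        obtain ⟨hxy, u, hu, w, hw, g, ⟨rfl, rfl⟩ | ⟨rfl, rfl⟩⟩ := he
        · exact ⟨x, y, g, rfl, hxy, hu, hw⟩
        · exact ⟨y, x, g, Sym2.eq_swap, hxy.symm, hw, hu⟩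
    choose a b g he hab hsrc htgt using hch
    have := Fintype.ofFinite Q.edgeSet
    have hinj : Function.Injective fun e : Q.edgeSet => s(a e, b e) := by
      intro e e' h
      simp only [he] at h
      exact Subtype.ext h
    have := card_edges_le_of_grid_minor a b hab hinj S' h1 h2 g hsrc htgt
    rwa [← Nat.card_eq_fintype_card, ← Nat.card_eq_fintype_card, Nat.card_coe_set_eq] at this
  · rintro d ⟨c, hc⟩ ⟨c', hc'⟩
    obtain ⟨x, hx, hxd⟩ := hc
    obtain ⟨y, hy, hyd⟩ := hc'
    have huniq : ∀ {c c' v}, v ∈ S' c → v ∈ S' c' → c = c' := by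
      intro c c' v h h'
      by_contra hne
      exact Set.disjoint_left.1 (h2 c c' hne) h h'
    have hcl := hT d {v | ∃ z, v ∈ S' z ∧ ∀ hz : (S z ∩ T d).Nonempty,
        (Q.induce {c | (S c ∩ T d).Nonempty}).Reachable ⟨c, ⟨x, hx, hxd⟩⟩ ⟨z, hz⟩}
      ⟨x, ⟨c, h3 c hx, fun _ => SimpleGraph.Reachable.refl _⟩, hxd⟩ ?_ hyd
    · obtain ⟨z, hz, hr⟩ := hcl
      obtain rfl := huniq hz (h3 c' hy)
      exact hr _
    · rintro u ⟨⟨z, huz, hr⟩, hud⟩ w hwd ha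
      obtain ⟨z', hwz⟩ := h5 d w hwd
      refine ⟨z', hwz, fun hz' => ?_⟩
      have hz := h4 z d ⟨u, huz, hud⟩
      by_cases hzz : z = z'
      · subst hzz
        exact hr _
      · exact (hr hz).trans (SimpleGraph.Adj.reachable (show Q.Adj z z' from
          ⟨hzz, u, huz, w, hwz, ha⟩))

/-! ### From regions in the plane to lattice points -/

section Plane

open Set Metric Topology Filter

/-- The point of the plane at position `v` in the square lattice of mesh `ε`. -/
def latticePoint (ε : ℝ) (v : ℤ × ℤ) : ℝ × ℝ := (ε * v.1, ε * v.2)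

/-- The positions in the lattice of mesh `ε` whose points lie at distance less than `ε` from `K`,
in the maximum norm. -/
def latticeNear (ε : ℝ) (K : Set (ℝ × ℝ)) : Set (ℤ × ℤ) :=
  {v | ∃ x ∈ K, dist x (latticePoint ε v) < ε}

theorem mem_latticeNear_iff {ε : ℝ} {K : Set (ℝ × ℝ)} {v : ℤ × ℤ} :
    v ∈ latticeNear ε K ↔ latticePoint ε v ∈ thickening ε K := by
  rw [mem_thickening_iff]
  simp only [dist_comm]
  rfl

theorem exists_dist_latticePoint_lt {ε : ℝ} (hε : 0 < ε) (x : ℝ × ℝ) :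
    ∃ v, dist x (latticePoint ε v) < ε := by
  have key : ∀ t : ℝ, dist t (ε * (⌊t / ε⌋ : ℤ)) < ε := by
    intro t
    have h1 := Int.floor_le (t / ε)
    have h2 := Int.lt_floor_add_one (t / ε)
    rw [le_div_iff₀ hε] at h1
    rw [div_lt_iff₀ hε] at h2
    rw [Real.dist_eq, abs_lt]
    constructor <;> nlinarith
  refine ⟨(⌊x.1 / ε⌋, ⌊x.2 / ε⌋), ?_⟩
  rw [Prod.dist_eq, max_lt_iff]
  exact ⟨key _, key _⟩

theorem abs_sub_le_one_of_dist_lt {ε t : ℝ} (hε : 0 < ε) {m n : ℤ} (hm : dist t (ε * m) < ε)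
    (hn : dist t (ε * n) < ε) : |m - n| ≤ 1 := by
  rw [Real.dist_eq, abs_lt] at hm hn
  have h1 : ((m - n : ℤ) : ℝ) < (2 : ℤ) := by
    push_cast
    by_contra! h
    nlinarith
  have h2 : ((n - m : ℤ) : ℝ) < (2 : ℤ) := by
    push_cast
    by_contra! h
    nlinarith
  have h3 := Int.cast_lt.1 h1
  have h4 := Int.cast_lt.1 h2
  rw [abs_le]
  omega

theorem gridAdj_of_fst {v w : ℤ × ℤ} (h1 : |v.1 - w.1| ≤ 1) (h2 : v.2 = w.2) (hne : v ≠ w) :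
    GridAdj v w := by
  obtain ⟨i, j⟩ := v
  obtain ⟨i', j'⟩ := w
  simp only [ne_eq, Prod.mk.injEq, abs_le] at *
  rcases lt_or_gt_of_ne (show i ≠ i' from fun h => hne ⟨h, h2⟩) with h | h
  · exact ⟨((i, j), false), Or.inl ⟨rfl, by simp [GridEdge.tgt]; omega⟩⟩
  · exact ⟨((i', j'), false), Or.inr ⟨rfl, by simp [GridEdge.tgt]; omega⟩⟩

theorem gridAdj_of_snd {v w : ℤ × ℤ} (h1 : |v.2 - w.2| ≤ 1) (h2 : v.1 = w.1) (hne : v ≠ w) :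
    GridAdj v w := by
  obtain ⟨i, j⟩ := v
  obtain ⟨i', j'⟩ := w
  simp only [ne_eq, Prod.mk.injEq, abs_le] at *
  rcases lt_or_gt_of_ne (show j ≠ j' from fun h => hne ⟨h2, h⟩) with h | h
  · exact ⟨((i, j), true), Or.inl ⟨rfl, by simp [GridEdge.tgt]; omega⟩⟩
  · exact ⟨((i', j'), true), Or.inr ⟨rfl, by simp [GridEdge.tgt]; omega⟩⟩

/-- The lattice points near a connected set are connected: the open squares about them cover the
set, and where squares of two points overlap, they overlap with that of a common neighbour. -/
theorem IsPreconnected.gridConnected_latticeNear {ε : ℝ} (hε : 0 < ε) {K : Set (ℝ × ℝ)}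
    (hK : IsPreconnected K) : GridConnected (latticeNear ε K) := by
  intro A hA hcl
  by_contra hsub
  obtain ⟨w₀, ⟨x₀, hx₀, hw₀⟩, hw₀A⟩ := not_subset.1 hsub
  obtain ⟨v₀, hv₀A, y₀, hy₀, hv₀⟩ := hA
  let U : Set (ℝ × ℝ) := ⋃ v ∈ A, ball (latticePoint ε v) ε
  let V : Set (ℝ × ℝ) := ⋃ v ∈ Aᶜ, ball (latticePoint ε v) ε
  obtain ⟨x, hxK, hxU, hxV⟩ := hK U V (isOpen_biUnion fun _ _ => isOpen_ball)
    (isOpen_biUnion fun _ _ => isOpen_ball)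
    (fun x _ => by
      obtain ⟨v, hv⟩ := exists_dist_latticePoint_lt hε x
      by_cases hvA : v ∈ A
      · exact Or.inl (mem_biUnion hvA hv)
      · exact Or.inr (mem_biUnion (s := Aᶜ) hvA hv))
    ⟨y₀, hy₀, mem_biUnion hv₀A hv₀⟩ ⟨x₀, hx₀, mem_biUnion (s := Aᶜ) hw₀A hw₀⟩
  obtain ⟨v, hvA, hv⟩ := mem_iUnion₂.1 hxU
  obtain ⟨w, hwA, hw⟩ := mem_iUnion₂.1 hxV
  have hvN : v ∈ latticeNear ε K := ⟨x, hxK, hv⟩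
  have hwN : w ∈ latticeNear ε K := ⟨x, hxK, hw⟩
  rw [mem_ball, Prod.dist_eq, max_lt_iff] at hv hw
  have hmN : (w.1, v.2) ∈ latticeNear ε K := by
    refine ⟨x, hxK, ?_⟩
    rw [Prod.dist_eq, max_lt_iff]
    exact ⟨hw.1, hv.2⟩
  have hmA : (w.1, v.2) ∈ A := by
    by_cases hvm : v = (w.1, v.2)
    · rwa [hvm] at hvA
    · exact hcl v ⟨hvA, hvN⟩ _ hmN
        (gridAdj_of_fst (abs_sub_le_one_of_dist_lt hε hv.1 hw.1) rfl hvm)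
  apply hwA
  by_cases hwm : (w.1, v.2) = w
  · rwa [hwm] at hmA
  · exact hcl _ ⟨hmA, hmN⟩ _ hwN
      (gridAdj_of_snd (abs_sub_le_one_of_dist_lt hε hv.2 hw.2) rfl hwm)

theorem IsCompact.finite_latticeNear {ε : ℝ} (hε : 0 < ε) {K : Set (ℝ × ℝ)}
    (hK : IsCompact K) : (latticeNear ε K).Finite := by
  obtain ⟨r, hr⟩ := hK.isBounded.subset_closedBall 0
  have key : ∀ {t : ℝ} {m : ℤ}, |t| ≤ r → dist t (ε * m) < ε →
      m ∈ Icc (-⌈r / ε + 1⌉) ⌈r / ε + 1⌉ := by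
    intro t m ht hm
    rw [Real.dist_eq, abs_lt] at hm
    rw [abs_le] at ht
    have h1 : (m : ℝ) ≤ r / ε + 1 := by
      rw [div_add_one hε.ne', le_div_iff₀ hε]; linarith
    have h2 : ((-m : ℤ) : ℝ) ≤ r / ε + 1 := by
      rw [div_add_one hε.ne', le_div_iff₀ hε]; push_cast; linarith
    have h3 : m ≤ ⌈r / ε + 1⌉ := Int.cast_le.1 (h1.trans (Int.le_ceil _))
    have h4 : -m ≤ ⌈r / ε + 1⌉ := Int.cast_le.1 (h2.trans (Int.le_ceil _))
    exact ⟨by omega, h3⟩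
  refine (((finite_Icc (-⌈r / ε + 1⌉) ⌈r / ε + 1⌉)).prod
    (finite_Icc (-⌈r / ε + 1⌉) ⌈r / ε + 1⌉)).subset ?_
  rintro v ⟨x, hxK, hx⟩
  have hxr := hr hxK
  rw [mem_closedBall_zero_iff, Prod.norm_def, max_le_iff] at hxr
  rw [Prod.dist_eq, max_lt_iff] at hx
  exact ⟨key hxr.1 hx.1, key hxr.2 hx.2⟩

/-- A compact subset of a path-connected open set lies in the interior of a compact connected one:
cover it by finitely many balls and join these by paths. -/
theorem IsPathConnected.exists_isCompact_isPreconnected {E : Type*} [NormedAddCommGroup E]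
    [NormedSpace ℝ E] [ProperSpace E] {U K : Set E} (hU : IsPathConnected U) (hUo : IsOpen U)
    (hK : IsCompact K) (hKU : K ⊆ U) :
    ∃ K' : Set E, IsCompact K' ∧ IsPreconnected K' ∧ K ⊆ interior K' ∧ K' ⊆ U := by
  obtain ⟨p, hp, hjoin⟩ := hU
  have hloc : ∀ x ∈ K, ∃ B : Set E, IsCompact B ∧ IsPreconnected B ∧ p ∈ B ∧ B ⊆ U ∧
      interior B ∈ 𝓝 x := by
    intro x hx
    obtain ⟨r, hr, hrU⟩ := Metric.nhds_basis_closedBall.mem_iff.1 (hUo.mem_nhds (hKU hx))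
    obtain ⟨γ, hγ⟩ := hjoin (hKU hx)
    refine ⟨range γ ∪ closedBall x r, ?_, ?_, ?_, ?_, ?_⟩
    · exact (isCompact_range γ.continuous).union (isCompact_closedBall x r)
    · exact (isPreconnected_range γ.continuous).union x ⟨1, γ.target⟩ (mem_closedBall_self hr.le)
        (convex_closedBall x r).isPreconnected
    · exact Or.inl ⟨0, γ.source⟩
    · refine union_subset ?_ hrU
      rintro _ ⟨t, rfl⟩
      exact hγ t
    · exact interior_mem_nhds.2 (mem_of_superset (closedBall_mem_nhds x hr) subset_union_right)
  choose! B hBc hBp hpB hBU hBn using hloc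
  obtain ⟨t, htK, ht⟩ := hK.elim_nhds_subcover _ hBn
  refine ⟨⋃ x ∈ t, B x, t.isCompact_biUnion fun x hx => hBc x (htK x hx), ?_, ?_,
    iUnion₂_subset fun x hx => hBU x (htK x hx)⟩
  · rw [show ⋃ x ∈ t, B x = ⋃₀ (B '' t) by rw [sUnion_image]; rfl]
    refine isPreconnected_sUnion p _ ?_ ?_
    · rintro _ ⟨x, hx, rfl⟩
      exact hpB x (htK x hx)
    · rintro _ ⟨x, hx, rfl⟩
      exact hBp x (htK x hx)
  · refine ht.trans (iUnion₂_subset fun x hx => interior_mono ?_)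
    exact subset_biUnion_of_mem (u := B) hx

/-- Path-connected open sets `D d` of the plane that overlap only in disjoint path-connected open
sets `C c` give rise to a planar graph on the `C c` that is connected along every `D d`. -/
theorem exists_simpleGraph_of_isOpen {κ ι : Type*} [Finite κ] [Finite ι] (C : κ → Set (ℝ × ℝ))
    (D : ι → Set (ℝ × ℝ)) (hC : ∀ c, IsPathConnected (C c)) (hCo : ∀ c, IsOpen (C c))
    (hD : ∀ d, IsPathConnected (D d)) (hDo : ∀ d, IsOpen (D d))
    (hdisj : ∀ c c', c ≠ c' → Disjoint (C c) (C c'))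
    (hCD : ∀ c d, (C c ∩ D d).Nonempty → C c ⊆ D d) (hmeet : ∀ d, ∃ c, C c ⊆ D d)
    (hDD : ∀ d d', d ≠ d' → ∀ x ∈ D d ∩ D d', ∃ c, x ∈ C c) :
    ∃ Q : SimpleGraph κ, Q.edgeSet.ncard ≤ 3 * Nat.card κ ∧
      ∀ d, (Q.induce {c | C c ⊆ D d}).Preconnected := by
  classical
  choose p hp using fun c => (hC c).nonempty
  -- compact connected cores of the `D d`, reaching into every `C c` inside
  have hγ : ∀ d, ∃ K : Set (ℝ × ℝ), IsCompact K ∧ IsPreconnected K ∧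
      p '' {c | C c ⊆ D d} ⊆ interior K ∧ K ⊆ D d := fun d =>
    (hD d).exists_isCompact_isPreconnected (hDo d) (toFinite _).isCompact (by
      rintro _ ⟨c, hc, rfl⟩
      exact hc (hp c))
  choose γ hγc hγp hpγ hγD using hγ
  -- compact connected cores of the `C c`, containing all overlaps of the former in their interior
  let X : κ → Set (ℝ × ℝ) := fun c =>
    {p c} ∪ ⋃ i ∈ {i : ι × ι | i.1 ≠ i.2}, γ i.1 ∩ γ i.2 ∩ C c
  have hX : ∀ c, IsCompact (X c) := by
    intro c
    refine isCompact_singleton.union ((toFinite _).isCompact_biUnion fun i hi => ?_)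
    have : γ i.1 ∩ γ i.2 ∩ C c = (γ i.1 ∩ γ i.2) \ ⋃ c' ∈ {c' | c' ≠ c}, C c' := by
      ext x
      constructor
      · rintro ⟨hx, hxc⟩
        refine ⟨hx, fun h => ?_⟩
        obtain ⟨c', hc', hx'⟩ := mem_iUnion₂.1 h
        exact disjoint_left.1 (hdisj c' c hc') hx' hxc
      · rintro ⟨hx, hxU⟩
        obtain ⟨c', hc'⟩ := hDD _ _ hi x ⟨hγD _ hx.1, hγD _ hx.2⟩
        by_cases h : c' = c
        · subst h; exact ⟨hx, hc'⟩
        · exact absurd (mem_biUnion (s := {c' | c' ≠ c}) h hc') hxU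
    rw [this]
    exact ((hγc _).inter (hγc _)).diff (isOpen_biUnion fun c' _ => hCo c')
  have hXC : ∀ c, X c ⊆ C c := fun c =>
    union_subset (singleton_subset_iff.2 (hp c)) (iUnion₂_subset fun i _ => inter_subset_right)
  choose K hKc hKp hXK hKC using fun c =>
    (hC c).exists_isCompact_isPreconnected (hCo c) (hX c) (hXC c)
  have hthick : ∀ {s : Set (ℝ × ℝ)} {P : Set (ℝ × ℝ) → Prop}, (∀ t t', t ⊆ t' → P t' → P t) →
      (∃ δ, 0 < δ ∧ P (thickening δ s)) → ∀ᶠ ε : ℝ in 𝓝[>] 0, P (thickening ε s) := by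
    rintro s P hP ⟨δ, hδ, h⟩
    filter_upwards [Ioo_mem_nhdsGT hδ] with ε hε
    exact hP _ _ (thickening_mono hε.2.le s) h
  have hγε : ∀ᶠ ε : ℝ in 𝓝[>] 0, ∀ d, thickening ε (γ d) ⊆ D d := eventually_all.2 fun d =>
    hthick (P := (· ⊆ D d)) (fun _ _ => Subset.trans)
      ((hγc d).exists_thickening_subset_open (hDo d) (hγD d))
  have hKε : ∀ᶠ ε : ℝ in 𝓝[>] 0, ∀ c, thickening ε (K c) ⊆ C c := eventually_all.2 fun c =>
    hthick (P := (· ⊆ C c)) (fun _ _ => Subset.trans)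
      ((hKc c).exists_thickening_subset_open (hCo c) (hKC c))
  -- away from the interiors of the cores `K c`, the cores `γ d` are a positive distance apart
  have hsep : ∀ᶠ ε : ℝ in 𝓝[>] 0, ∀ d d', d ≠ d' →
      Disjoint (thickening ε (γ d \ ⋃ c, interior (K c))) (thickening ε (γ d')) := by
    refine eventually_all.2 fun d => eventually_all.2 fun d' => ?_
    by_cases hdd : d = d'
    · exact Eventually.of_forall fun _ h => absurd hdd h
    have h0 : Disjoint (γ d \ ⋃ c, interior (K c)) (γ d') := by
      refine disjoint_left.2 fun x hx hx' => hx.2 ?_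
      obtain ⟨c, hc⟩ := hDD d d' hdd x ⟨hγD d hx.1, hγD d' hx'⟩
      refine mem_iUnion.2 ⟨c, hXK c (Or.inr ?_)⟩
      exact mem_biUnion (x := (d, d')) (show (d, d') ∈ {i : ι × ι | i.1 ≠ i.2} from hdd)
        ⟨⟨hx.1, hx'⟩, hc⟩
    obtain ⟨δ, hδ, h⟩ := h0.exists_thickenings
      ((hγc d).diff (isOpen_iUnion fun c => isOpen_interior)) (hγc d').isClosed
    filter_upwards [Ioo_mem_nhdsGT hδ] with ε hε _
    exact h.mono (thickening_mono hε.2.le _) (thickening_mono hε.2.le _)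
  obtain ⟨ε, hεγ, hεK, hεs, hε⟩ :=
    (hγε.and (hKε.and (hsep.and self_mem_nhdsWithin))).exists
  have hε : 0 < ε := hε
  have hSC : ∀ {c v}, v ∈ latticeNear ε (K c) → latticePoint ε v ∈ C c := fun h =>
    hεK _ (mem_latticeNear_iff.1 h)
  have hTD : ∀ {d v}, v ∈ latticeNear ε (γ d) → latticePoint ε v ∈ D d := fun h =>
    hεγ _ (mem_latticeNear_iff.1 h)
  have hiff : ∀ c d, (latticeNear ε (K c) ∩ latticeNear ε (γ d)).Nonempty ↔ C c ⊆ D d := by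
    intro c d
    constructor
    · rintro ⟨v, hv, hv'⟩
      exact hCD c d ⟨_, hSC hv, hTD hv'⟩
    · intro h
      obtain ⟨v, hv⟩ := exists_dist_latticePoint_lt hε (p c)
      exact ⟨v, ⟨p c, interior_subset (hXK c (Or.inl rfl)), hv⟩,
        ⟨p c, interior_subset (hpγ d ⟨c, h, rfl⟩), hv⟩⟩
  obtain ⟨Q, hQ, hQc⟩ := exists_simpleGraph_of_grid (fun c => latticeNear ε (K c))
    (fun d => latticeNear ε (γ d)) (fun c => (hKp c).gridConnected_latticeNear hε)
    (fun d => (hγp d).gridConnected_latticeNear hε) (fun d => (hγc d).finite_latticeNear hε)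
    (fun c c' h => disjoint_left.2 fun v hv hv' =>
      disjoint_left.1 (hdisj c c' h) (hSC hv) (hSC hv'))
    (fun d => (hmeet d).imp fun c h => (hiff c d).2 h)
    (fun d d' h v ⟨hv, hv'⟩ => by
      obtain ⟨x, hx, hxv⟩ := hv
      by_cases hxK : x ∈ ⋃ c, interior (K c)
      · obtain ⟨c, hc⟩ := mem_iUnion.1 hxK
        exact ⟨c, x, interior_subset hc, hxv⟩
      · refine absurd (mem_latticeNear_iff.1 hv') (disjoint_left.1 (hεs d d' h) ?_)
        exact mem_latticeNear_iff.1 ⟨x, ⟨hx, hxK⟩, hxv⟩)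
  refine ⟨Q, hQ, fun d => ?_⟩
  rw [show {c | C c ⊆ D d} = {c | (latticeNear ε (K c) ∩ latticeNear ε (γ d)).Nonempty} from
    Set.ext fun c => (hiff c d).symm]
  exact hQc d

end Plane

/-! ### Path components of intersections -/

section Components

open Set

/-- The path components of a set, as subsets of the ambient space. -/
def pathComponentsIn {X : Type*} [TopologicalSpace X] (S : Set X) : Set (Set X) :=
  pathComponentIn S '' S

theorem PlanarNerve.HasAtMostPathComponents.encard_le {X : Type*} [TopologicalSpace X] {S : Set X}
    {b : ℕ} (h : PlanarNerve.HasAtMostPathComponents S b) :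
    (pathComponentsIn S).encard ≤ b := by
  refine le_trans ?_ h
  let f : ZerothHomotopy S → Set X :=
    Quotient.lift (fun x : S => pathComponentIn S x) (by
      intro x y hxy
      exact (pathComponentIn_congr (joinedIn_iff_joined x.2 y.2 |>.2 hxy)).symm)
  have : pathComponentsIn S = range f := by
    ext C
    constructor
    · rintro ⟨x, hx, rfl⟩
      exact ⟨Quotient.mk _ ⟨x, hx⟩, rfl⟩
    · rintro ⟨q, rfl⟩
      induction q using Quotient.inductionOn with
      | _ x => exact ⟨x, x.2, rfl⟩
  rw [this, ← image_univ]
  refine (encard_image_le _ _).trans ?_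
  rw [encard_univ]

section PathComponents

variable {X : Type*} [TopologicalSpace X] {S C : Set X}

theorem eq_pathComponentIn_of_mem (hC : C ∈ pathComponentsIn S) {x : X} (hx : x ∈ C) :
    C = pathComponentIn S x := by
  obtain ⟨y, -, rfl⟩ := hC
  exact (pathComponentIn_congr hx).symm

theorem subset_of_mem_pathComponentsIn (hC : C ∈ pathComponentsIn S) : C ⊆ S := by
  obtain ⟨y, -, rfl⟩ := hC
  exact pathComponentIn_subset

theorem isPathConnected_of_mem_pathComponentsIn (hC : C ∈ pathComponentsIn S) :
    IsPathConnected C := by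
  obtain ⟨y, hy, rfl⟩ := hC
  exact isPathConnected_pathComponentIn hy

theorem isOpen_of_mem_pathComponentsIn [LocallyPathConnectedSpace X] (hS : IsOpen S)
    (hC : C ∈ pathComponentsIn S) : IsOpen C := by
  obtain ⟨y, hy, rfl⟩ := hC
  exact hS.pathComponentIn y

end PathComponents

theorem Set.finite_and_ncard_le_of_fiber_encard_le {α β : Type*} {F : Set α} (hF : F.Finite)
    (V : α → Set β) {b : ℕ} (h : ∀ a ∈ F, (V a).encard ≤ b) :
    {q : α × β | q.1 ∈ F ∧ q.2 ∈ V q.1}.Finite ∧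
      {q : α × β | q.1 ∈ F ∧ q.2 ∈ V q.1}.ncard ≤ b * F.ncard := by
  classical
  have hfin : ∀ a ∈ F, (V a).Finite := fun a ha => finite_of_encard_le_coe (h a ha)
  let W : α → Finset (α × β) := fun a =>
    if ha : a ∈ F then (hfin a ha).toFinset.image (Prod.mk a) else ∅
  have hsub : {q : α × β | q.1 ∈ F ∧ q.2 ∈ V q.1} ⊆ (hF.toFinset.biUnion W : Finset (α × β)) := by
    rintro ⟨a, x⟩ ⟨ha, hx⟩
    refine Finset.mem_coe.2 (Finset.mem_biUnion.2 ⟨a, hF.mem_toFinset.2 ha, ?_⟩)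
    simp only [W, dif_pos ha]
    exact Finset.mem_image_of_mem _ ((hfin a ha).mem_toFinset.2 hx)
  refine ⟨(Finset.finite_toSet _).subset hsub,
    (ncard_le_ncard hsub (Finset.finite_toSet _)).trans ?_⟩
  rw [ncard_coe_finset, mul_comm, ncard_eq_toFinset_card F hF]
  refine Finset.card_biUnion_le_card_mul _ _ _ fun a ha => ?_
  have ha := hF.mem_toFinset.1 ha
  simp only [W, dif_pos ha]
  refine Finset.card_image_le.trans ?_
  rw [← ncard_eq_toFinset_card (V a) (hfin a ha)]
  have := h a ha
  rw [← (hfin a ha).cast_ncard_eq] at this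
  exact_mod_cast this

namespace PlanarNerve

theorem mem_interOf {X : Type*} {n : ℕ} {A : Fin n → Set X} {σ : Finset (Fin n)} {x : X} :
    x ∈ interOf A σ ↔ ∀ i ∈ σ, x ∈ A i := mem_iInter₂

/-- The inequality `(k - 2 b) f_k ≤ b f_{k-1}^ind`, with the negative term moved to the right. -/
theorem mul_fNum_le (b k n : ℕ) (hk : 0 < k) (A : Fin n → Set (EuclideanSpace ℝ (Fin 2)))
    (hf : fNum A (k + 1) = 0)
    (hA : ∀ σ : Finset (Fin n), σ.card = k ∨ σ.card = k + 1 →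
      IsOpen (interOf A σ) ∧ HasAtMostPathComponents (interOf A σ) b) :
    k * fNum A k ≤ 2 * (b * fNum A k) + b * fInd A (k - 1) := by
  classical
  -- no point lies in `k + 2` of the sets
  have hbig : ∀ σ x, x ∈ interOf A σ → σ.card ≤ k + 1 := by
    intro σ x hx
    by_contra! h
    obtain ⟨ρ, hρσ, hρ⟩ := Finset.exists_subset_card_eq (s := σ) (n := k + 1 + 1) (by omega)
    rw [fNum, ncard_eq_zero (toFinite _)] at hf
    have : ρ ∈ (∅ : Set (Finset (Fin n))) := by
      rw [← hf]
      exact ⟨⟨x, mem_interOf.2 fun i hi => mem_interOf.1 hx i (hρσ hi)⟩, hρ⟩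
    exact this
  have hunion : ∀ {σ τ x}, x ∈ interOf A σ → x ∈ interOf A τ → x ∈ interOf A (σ ∪ τ) := by
    intro σ τ x h h'
    refine mem_interOf.2 fun i hi => ?_
    rcases Finset.mem_union.1 hi with hi | hi
    · exact mem_interOf.1 h i hi
    · exact mem_interOf.1 h' i hi
  have hanti : ∀ {σ τ : Finset (Fin n)}, τ ⊆ σ → interOf A σ ⊆ interOf A τ := fun h x hx =>
    mem_interOf.2 fun i hi => mem_interOf.1 hx i (h hi)
  have hmax : ∀ {σ τ x}, σ.card = k + 1 → x ∈ interOf A σ → x ∈ interOf A τ → τ ⊆ σ := by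
    intro σ τ x hσ h h'
    have h1 := hbig _ _ (hunion h h')
    have h2 : σ = σ ∪ τ := Finset.eq_of_subset_of_card_le Finset.subset_union_left (by omega)
    rw [h2]
    exact Finset.subset_union_right
  let Cset : Set (Finset (Fin n) × Set (EuclideanSpace ℝ (Fin 2))) :=
    {q | q.1.card = k + 1 ∧ q.2 ∈ pathComponentsIn (interOf A q.1)}
  let Dset : Set (Finset (Fin n) × Set (EuclideanSpace ℝ (Fin 2))) :=
    {p | p.1.card = k ∧ p.2 ∈ pathComponentsIn (interOf A p.1) ∧ ∃ q ∈ Cset, q.2 ⊆ p.2}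
  have hsub : ∀ q ∈ Cset, ∀ p ∈ Dset, (q.2 ∩ p.2).Nonempty → p.1 ⊆ q.1 ∧ q.2 ⊆ p.2 := by
    rintro q hq p hp ⟨x, hxq, hxp⟩
    have h1 := hmax hq.1 (subset_of_mem_pathComponentsIn hq.2 hxq)
      (subset_of_mem_pathComponentsIn hp.2.1 hxp)
    refine ⟨h1, ?_⟩
    rw [eq_pathComponentIn_of_mem hp.2.1 hxp]
    exact (isPathConnected_of_mem_pathComponentsIn hq.2).subset_pathComponentIn hxq
      ((subset_of_mem_pathComponentsIn hq.2).trans (hanti h1))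
  have hsub' : ∀ q ∈ Cset, ∀ p ∈ Dset, q.2 ⊆ p.2 → p.1 ⊆ q.1 := by
    intro q hq p hp h
    obtain ⟨x, hx⟩ := (isPathConnected_of_mem_pathComponentsIn hq.2).nonempty
    exact (hsub q hq p hp ⟨x, hx, h hx⟩).1
  -- there are at most `b f_k` and `b f_{k-1}^ind` components to consider
  have hCfin : Cset.Finite ∧ Cset.ncard ≤ b * fNum A k := by
    have h := finite_and_ncard_le_of_fiber_encard_le
      (F := {σ | σ ∈ nerve A ∧ σ.card = k + 1}) (toFinite _)
      (fun σ => pathComponentsIn (interOf A σ)) (b := b)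
      fun σ hσ => (hA σ (Or.inr hσ.2)).2.encard_le
    have hs : Cset ⊆ {q | q.1 ∈ {σ | σ ∈ nerve A ∧ σ.card = k + 1} ∧
        q.2 ∈ pathComponentsIn (interOf A q.1)} := by
      rintro ⟨σ, C⟩ ⟨hσ, hC⟩
      exact ⟨⟨hC.imp fun x hx => hx.1, hσ⟩, hC⟩
    exact ⟨h.1.subset hs, (ncard_le_ncard hs h.1).trans h.2⟩
  have hDfin : Dset.Finite ∧ Dset.ncard ≤ b * fInd A (k - 1) := by
    have h := finite_and_ncard_le_of_fiber_encard_le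
      (F := {τ | τ ∈ nerve A ∧ τ.card = k - 1 + 1 ∧
        ∃ σ ∈ nerve A, τ ⊂ σ ∧ σ.card = k - 1 + 2}) (toFinite _)
      (fun σ => pathComponentsIn (interOf A σ)) (b := b)
      fun σ hσ => (hA σ (Or.inl (by have := hσ.2.1; omega))).2.encard_le
    have hs : Dset ⊆ {q | q.1 ∈ {τ | τ ∈ nerve A ∧ τ.card = k - 1 + 1 ∧
        ∃ σ ∈ nerve A, τ ⊂ σ ∧ σ.card = k - 1 + 2} ∧
        q.2 ∈ pathComponentsIn (interOf A q.1)} := by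
      intro p hp
      obtain ⟨q, hq, hqp⟩ := hp.2.2
      obtain ⟨x, hx⟩ := (isPathConnected_of_mem_pathComponentsIn hq.2).nonempty
      have h1 := hp.1
      have h2 := hq.1
      refine ⟨⟨⟨x, subset_of_mem_pathComponentsIn hp.2.1 (hqp hx)⟩, by omega, q.1,
        ⟨x, subset_of_mem_pathComponentsIn hq.2 hx⟩, ?_, by omega⟩, hp.2.1⟩
      refine Finset.ssubset_iff_subset_ne.2 ⟨hsub' q hq p hp hqp, fun h => ?_⟩
      rw [h] at h1
      omega
    exact ⟨h.1.subset hs, (ncard_le_ncard hs h.1).trans h.2⟩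
  have := hCfin.1.to_subtype
  have := hDfin.1.to_subtype
  let e : EuclideanSpace ℝ (Fin 2) ≃ₜ ℝ × ℝ :=
    (EuclideanSpace.equiv (Fin 2) ℝ).toHomeomorph.trans Homeomorph.finTwoArrow
  have hdisj : ∀ q ∈ Cset, ∀ q' ∈ Cset, q ≠ q' → Disjoint q.2 q'.2 := by
    intro q hq q' hq' hne
    refine disjoint_left.2 fun x hx hx' => hne ?_
    have h1 : q.1 = q'.1 :=
      (hmax hq'.1 (subset_of_mem_pathComponentsIn hq'.2 hx')
        (subset_of_mem_pathComponentsIn hq.2 hx)).antisymm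
      (hmax hq.1 (subset_of_mem_pathComponentsIn hq.2 hx)
        (subset_of_mem_pathComponentsIn hq'.2 hx'))
    refine Prod.ext h1 ?_
    rw [eq_pathComponentIn_of_mem hq.2 hx, eq_pathComponentIn_of_mem hq'.2 hx', h1]
  have heq : ∀ p ∈ Dset, ∀ p' ∈ Dset, (p.2 ∩ p'.2).Nonempty → p.1 = p'.1 → p = p' := by
    rintro p hp p' hp' ⟨x, hx, hx'⟩ h
    refine Prod.ext h ?_
    rw [eq_pathComponentIn_of_mem hp.2.1 hx, eq_pathComponentIn_of_mem hp'.2.1 hx', h]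
  obtain ⟨Q, hQ, hQc⟩ := exists_simpleGraph_of_isOpen (fun c : Cset => e '' c.1.2)
    (fun d : Dset => e '' d.1.2)
    (fun c => (isPathConnected_of_mem_pathComponentsIn c.2.2).image e.continuous)
    (fun c => e.isOpenMap _ (isOpen_of_mem_pathComponentsIn (hA _ (Or.inr c.2.1)).1 c.2.2))
    (fun d => (isPathConnected_of_mem_pathComponentsIn d.2.2.1).image e.continuous)
    (fun d => e.isOpenMap _ (isOpen_of_mem_pathComponentsIn (hA _ (Or.inl d.2.1)).1 d.2.2.1))
    (fun c c' h => (disjoint_image_iff e.injective).2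
      (hdisj c c.2 c' c'.2 fun h' => h (Subtype.ext h')))
    (fun c d h => by
      rw [← image_inter e.injective, image_nonempty] at h
      exact image_mono (hsub c c.2 d d.2 h).2)
    (fun d => by
      obtain ⟨q, hq, hqd⟩ := d.2.2.2
      exact ⟨⟨q, hq⟩, image_mono hqd⟩)
    (fun d d' hne x hx => by
      rw [← image_inter e.injective] at hx
      obtain ⟨x, ⟨hx, hx'⟩, rfl⟩ := hx
      -- two distinct sets of size `k` whose `A`-sets meet have a union of size `k + 1`
      have hτ : d.1.1 ≠ d'.1.1 := fun h =>
        hne (Subtype.ext (heq d d.2 d' d'.2 ⟨x, hx, hx'⟩ h))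
      have hxU := hunion (subset_of_mem_pathComponentsIn d.2.2.1 hx)
        (subset_of_mem_pathComponentsIn d'.2.2.1 hx')
      have hU : (d.1.1 ∪ d'.1.1).card = k + 1 := by
        refine le_antisymm (hbig _ _ hxU) ?_
        by_contra! hlt
        have h1 := d.2.1
        have h2 := d'.2.1
        have h3 : d.1.1 = d.1.1 ∪ d'.1.1 :=
          Finset.eq_of_subset_of_card_le Finset.subset_union_left (by omega)
        have h4 : d'.1.1 = d.1.1 ∪ d'.1.1 :=
          Finset.eq_of_subset_of_card_le Finset.subset_union_right (by omega)
        exact hτ (h3.trans h4.symm)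
      exact ⟨⟨(d.1.1 ∪ d'.1.1, pathComponentIn (interOf A (d.1.1 ∪ d'.1.1)) x), hU, x, hxU, rfl⟩,
        mem_image_of_mem e (mem_pathComponentIn_self hxU)⟩)
  have hQc' : ∀ d : Dset, (Q.induce {c : Cset | c.1.2 ⊆ d.1.2}).Preconnected := by
    intro d
    rw [show {c : Cset | c.1.2 ⊆ d.1.2} = {c | e '' c.1.2 ⊆ e '' d.1.2} from
      Set.ext fun c => (image_subset_image_iff e.injective).symm]
    exact hQc d
  have hmain := mul_ncard_range_label_le k Q (fun c : Cset => c.1.1) (fun d : Dset => d.1.1)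
    (fun c d => c.1.2 ⊆ d.1.2) hQ hQc' (fun c d h => hsub' c c.2 d d.2 h) (fun c => c.2.1)
    (fun d => d.2.1)
    (fun c j hj => by
      obtain ⟨x, hx⟩ := (isPathConnected_of_mem_pathComponentsIn c.2.2).nonempty
      have hCA := (subset_of_mem_pathComponentsIn c.2.2).trans (hanti (Finset.erase_subset j c.1.1))
      have hCD := (isPathConnected_of_mem_pathComponentsIn c.2.2).subset_pathComponentIn hx hCA
      refine ⟨⟨(c.1.1.erase j, pathComponentIn (interOf A (c.1.1.erase j)) x), ?_,
        ⟨x, hCA hx, rfl⟩, c.1, c.2, hCD⟩, hCD, rfl⟩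
      have := c.2.1
      rw [Finset.card_erase_of_mem hj]
      omega)
    (fun c d d' h h' hτ => by
      obtain ⟨x, hx⟩ := (isPathConnected_of_mem_pathComponentsIn c.2.2).nonempty
      exact Subtype.ext (heq d d.2 d' d'.2 ⟨x, h hx, h' hx⟩ hτ))
  have hrange : fNum A k ≤ (range fun c : Cset => c.1.1).ncard := by
    refine ncard_le_ncard ?_ (toFinite _)
    rintro σ ⟨⟨x, hx⟩, hσ⟩
    exact ⟨⟨(σ, pathComponentIn (interOf A σ) x), hσ, x, hx, rfl⟩, rfl⟩
  rw [Nat.card_coe_set_eq, Nat.card_coe_set_eq] at hmain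
  calc k * fNum A k ≤ k * _ := Nat.mul_le_mul_left k hrange
    _ ≤ 2 * Cset.ncard + Dset.ncard := hmain
    _ ≤ _ := Nat.add_le_add (Nat.mul_le_mul_left 2 hCfin.2) hDfin.2

end PlanarNerve

end Components

theorem theorem2p2 (b k n : ℕ) (hb : 2 ≤ b) (hk : 2 * b < k)
    (A : Fin n → Set (EuclideanSpace ℝ (Fin 2)))
    (hf : PlanarNerve.fNum A (k + 1) = 0)
    (hA : ∀ σ : Finset (Fin n), σ.card = k ∨ σ.card = k + 1 →
      IsOpen (PlanarNerve.interOf A σ) ∧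
        PlanarNerve.HasAtMostPathComponents (PlanarNerve.interOf A σ) b) :
    0 < (b : ℝ) / ((k : ℝ) - 2 * (b : ℝ)) ∧
      (PlanarNerve.fNum A k : ℝ) ≤
        (b : ℝ) / ((k : ℝ) - 2 * (b : ℝ)) * (PlanarNerve.fInd A (k - 1) : ℝ) := by
  have hb' : (0 : ℝ) < b := by exact_mod_cast (by omega : 0 < b)
  have hk' : (0 : ℝ) < (k : ℝ) - 2 * b := by
    have : ((2 * b : ℕ) : ℝ) < k := by exact_mod_cast hk
    push_cast at this
    linarith
  refine ⟨div_pos hb' hk', ?_⟩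
  have h := PlanarNerve.mul_fNum_le b k n (by omega) A hf hA
  have h' : (k : ℝ) * PlanarNerve.fNum A k ≤
      2 * (b * PlanarNerve.fNum A k) + b * PlanarNerve.fInd A (k - 1) := by exact_mod_cast h
  rw [div_mul_eq_mul_div, le_div_iff₀ hk']
  linarith
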